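/- All graphs are finite and simple, and $\mathbb{N}=\{0,1,2,\dots\}$. Let $G$ be a graph and let $f\colon V(G)\to\mathbb{N}$. For $u\in V(G)$, the operation $\mathrm{Delete}(G,f,u)$ outputs the graph $G-u$ and the function $f'\colon V(G-u)\to\mathbb{Z}$ with $f'(v)=f(v)-1$ if $uv\in E(G)$ and $f'(v)=f(v)$ otherwise; it is legal if $f'\ge 0$. For adjacent $u,w\in V(G)$, the operation $\mathrm{DelSave}(G,f,u,w)$ outputs the graph $G-u$ and the function $f'\colon V(G-u)\to\mathbb{Z}$ with $f'(v)=f(v)-1$ if $uv\in E(G)$ and $v\ne w$, and $f'(v)=f(v)$ otherwise; it is legal if $f(u)>f(w)$ and $f'\ge 0$. The graph $G$ is weakly $f$-degenerate if all its vertices can be removed by a sequence of legal applications of $\mathrm{Delete}$ and $\mathrm{DelSave}$, starting from $(G,f)$. The weak degeneracy $\mathsf{wd}(G)$ is the minimum $d\in\mathbb{N}$ such that $G$ is weakly degenerate with respect to the constant function $d$. **Theorem.** For each integer $k\ge 1$, there exist $c>0$ and $d_0\in\mathbb{N}$ such that if $G$ is a graph of maximum degree $d\ge d_0$ with chromatic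 number $\chi(G)\le k$, then $$\mathsf{wd}(G)\le d-c\sqrt{d}.$$ -/

import Mathlib

namespace SimpleGraph

universe u

variable {V : Type u}

open Classical in
/-- The function produced by the operation `Delete (G, f, u)`: every neighbor of `u` loses `1`.
Values are integers; only the values at remaining vertices other than `u` are ever used. -/
noncomputable def deleteFun (G : SimpleGraph V) (f : V → ℤ) (u : V) : V → ℤ :=
  fun v => if G.Adj u v then f v - 1 else f v

open Classical in
/-- The function produced by the operation `DelSave (G, f, u, w)`: every neighbor of `u` other
than `w` loses `1`. -/
noncomputable def delSaveFun (G : SimpleGraph V) (f : V → ℤ) (u w : V) : V → ℤ :=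
  fun v => if G.Adj u v ∧ v ≠ w then f v - 1 else f v

/-- `G.Removable S f`: starting from the induced subgraph `G[S]` and the function `f` on `S`, all
vertices can be removed by a sequence of legal applications of `Delete` and `DelSave`.
Since every graph obtained on the way is an induced subgraph of `G`, it is recorded by the set `S`
of its vertices. An application is legal if the new function is nonnegative on the
remaining vertices and, for `DelSave (G, f, u, w)`, moreover `f u > f w`. -/
inductive Removable (G : SimpleGraph V) : Set V → (V → ℤ) → Prop
  | done (f : V → ℤ) : Removable G ∅ f
  | delete (S : Set V) (f : V → ℤ) (u : V) (hu : u ∈ S)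
      (hnonneg : ∀ v ∈ S \ {u}, 0 ≤ G.deleteFun f u v)
      (hrest : Removable G (S \ {u}) (G.deleteFun f u)) : Removable G S f
  | delSave (S : Set V) (f : V → ℤ) (u w : V) (hu : u ∈ S) (hw : w ∈ S) (huw : G.Adj u w)
      (hlt : f w < f u)
      (hnonneg : ∀ v ∈ S \ {u}, 0 ≤ G.delSaveFun f u w v)
      (hrest : Removable G (S \ {u}) (G.delSaveFun f u w)) : Removable G S f

/-- `G` is weakly `f`-degenerate, for `f : V → ℕ`. -/
def WeaklyDegenerate (G : SimpleGraph V) (f : V → ℕ) : Prop :=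
  G.Removable Set.univ (fun v => (f v : ℤ))

/-- The weak degeneracy of `G`: the minimum `d` such that `G` is weakly `d`-degenerate (the
minimum is attained for every finite graph, see `weaklyDegenerate_weakDegeneracy`). -/
noncomputable def weakDegeneracy (G : SimpleGraph V) : ℕ :=
  sInf {d : ℕ | G.WeaklyDegenerate fun _ => d}

theorem removable_of_ncard_le [Finite V] (G : SimpleGraph V) (n : ℕ) :
    ∀ (S : Set V) (f : V → ℤ), S.ncard = n → (∀ v ∈ S, (n : ℤ) ≤ f v) → G.Removable S f := by
  induction n with
  | zero =>
    intro S f hS _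
    obtain rfl : S = ∅ := (Set.ncard_eq_zero).1 hS
    exact .done f
  | succ n ih =>
    intro S f hS hf
    obtain ⟨u, hu⟩ : S.Nonempty := by
      rw [← Set.ncard_pos, hS]; exact Nat.succ_pos n
    have key : ∀ v ∈ S \ {u}, (n : ℤ) ≤ G.deleteFun f u v := by
      intro v hv
      have := hf v hv.1
      push_cast at this
      unfold deleteFun
      split_ifs <;> omega
    refine .delete S f u hu (fun v hv => le_trans (by positivity) (key v hv)) (ih _ _ ?_ key)
    rw [Set.ncard_sdiff_singleton_of_mem hu, hS, Nat.add_sub_cancel]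

/-- The set whose infimum defines `weakDegeneracy` is nonempty for a finite graph, so the infimum
is a minimum. -/
theorem weaklyDegenerate_weakDegeneracy [Finite V] (G : SimpleGraph V) :
    G.WeaklyDegenerate fun _ => G.weakDegeneracy :=
  Nat.sInf_mem (s := {d : ℕ | G.WeaklyDegenerate fun _ => d})
    ⟨(Set.univ : Set V).ncard, G.removable_of_ncard_le _ _ _ rfl fun _ _ => le_rfl⟩

end SimpleGraph

/-!
Label the vertices independently at random: with probability about `1 / √d` a vertex is put in a
reserve, and it gets a uniform phase (one for each of the `k` colors) and a uniform half of that
phase. By Chernoff bounds and the local lemma, some labelling splits every neighborhood, up to a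
small multiple of `d`, in the expected proportions. Non-reserve vertices are removed phase by phase;
in phase `j` those of color `j` go first, in two halves, and the reserve is removed at the very end.

Fix `s` of order `√d` and let all initial values be `d - s`. A non-reserve vertex of degree more
than `d - s` has at least `s` neighbors in the reserve, which are removed after it. A reserve vertex
`w` of degree more than `d - s` has linearly many neighbors of some color `j` in the second half of
phase `j`. When such a neighbor `u` is removed, `w` has lost the color-`j` neighbors in the first
half of the phase, while `u`, having no neighbor of its own color, has lost only neighbors from
earlier phases, so the value at `u` exceeds the value at `w` and `u` may save `w`. Each `u` has only
`O(√d)` neighbors in the reserve, so Hall's theorem gives every such `w` enough private savers.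
-/

namespace WeakDegeneracy

open Finset MeasureTheory ProbabilityTheory SimpleGraph

section LocalLemma

variable {Ω ι : Type*} [MeasurableSpace Ω] {μ : Measure Ω} {A : ι → Set Ω} {N : ι → Finset ι}
  {p : ℝ}

theorem measureReal_inter_biInter_compl_le [IsFiniteMeasure μ] (hp : 0 ≤ p)
    (hpN : ∀ i, 4 * p * #(N i) ≤ 1)
    (hA : ∀ i (S : Finset ι), Disjoint S (N i) →
      μ.real (A i ∩ ⋂ j ∈ S, (A j)ᶜ) ≤ p * μ.real (⋂ j ∈ S, (A j)ᶜ)) (S : Finset ι) (i : ι) :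
    μ.real (A i ∩ ⋂ j ∈ S, (A j)ᶜ) ≤ 2 * p * μ.real (⋂ j ∈ S, (A j)ᶜ) := by
  classical
  induction S using Finset.strongInduction generalizing i with
  | H S ih =>
  set far : Set Ω := ⋂ j ∈ S \ N i, (A j)ᶜ
  set all : Set Ω := ⋂ j ∈ S, (A j)ᶜ
  have all_subset_far : all ⊆ far := Set.biInter_subset_biInter_left sdiff_subset
  suffices far_le : μ.real far ≤ 2 * μ.real all by
    calc μ.real (A i ∩ all) ≤ μ.real (A i ∩ far) :=
          measureReal_mono (Set.inter_subset_inter_right _ all_subset_far)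
      _ ≤ p * μ.real far := hA i _ sdiff_disjoint
      _ ≤ p * (2 * μ.real all) := mul_le_mul_of_nonneg_left far_le hp
      _ = 2 * p * μ.real all := by ring
  rcases (sdiff_subset : S \ N i ⊆ S).eq_or_ssubset with hS | hS
  · rw [show far = all by simp only [far, all, hS]]
    linarith [measureReal_nonneg (μ := μ) (s := all)]
  have far_subset : far ⊆ all ∪ ⋃ j ∈ N i, A j ∩ far := by
    intro ω hω
    by_cases hall : ω ∈ all
    · exact .inl hall
    obtain ⟨j, hjS, hj⟩ : ∃ j ∈ S, ω ∈ A j := by simpa [all] using hall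
    have hjN : j ∈ N i := by
      by_contra hjN
      exact Set.mem_iInter₂.1 hω j (mem_sdiff.2 ⟨hjS, hjN⟩) hj
    exact .inr (Set.mem_biUnion hjN ⟨hj, hω⟩)
  have near_le : μ.real (⋃ j ∈ N i, A j ∩ far) ≤ #(N i) * (2 * p * μ.real far) := by
    refine (measureReal_biUnion_finset_le _ _).trans ?_
    exact (sum_le_card_nsmul (N i) _ _ fun j _ => ih _ hS j).trans_eq (nsmul_eq_mul _ _)
  have half : 4 * p * #(N i) * μ.real far ≤ 1 * μ.real far :=
    mul_le_mul_of_nonneg_right (hpN i) measureReal_nonneg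
  linarith [(measureReal_mono (μ := μ) far_subset).trans (measureReal_union_le _ _)]

/-- The symmetric lopsided Lovász local lemma. -/
theorem measureReal_biInter_compl_pos [IsProbabilityMeasure μ] (hp : 0 ≤ p) (hp' : 2 * p < 1)
    (hpN : ∀ i, 4 * p * #(N i) ≤ 1)
    (hA : ∀ i (S : Finset ι), Disjoint S (N i) →
      μ.real (A i ∩ ⋂ j ∈ S, (A j)ᶜ) ≤ p * μ.real (⋂ j ∈ S, (A j)ᶜ)) (S : Finset ι) :
    0 < μ.real (⋂ j ∈ S, (A j)ᶜ) := by
  classical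
  induction S using Finset.induction_on with
  | empty => simp
  | insert i S _ ih =>
    have hcover : ⋂ j ∈ S, (A j)ᶜ ⊆
        (⋂ j ∈ insert i S, (A j)ᶜ) ∪ (A i ∩ ⋂ j ∈ S, (A j)ᶜ) := by
      rw [set_biInter_insert, ← Set.union_inter_distrib_right, Set.compl_union_self,
        Set.univ_inter]
    have hle := (measureReal_mono (μ := μ) hcover).trans (measureReal_union_le _ _)
    nlinarith [measureReal_inter_biInter_compl_le hp hpN hA S i]

end LocalLemma

section Chernoff

variable {Ω ι : Type*} [MeasurableSpace Ω] {μ : Measure Ω} [IsProbabilityMeasure μ]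

theorem mgf_indicator_one {E : Set Ω} (hE : MeasurableSet E) (l : ℝ) :
    mgf (E.indicator 1) μ l = 1 + μ.real E * (Real.exp l - 1) := by
  have hexp : (fun ω => Real.exp (l * E.indicator 1 ω)) =
      fun ω => 1 + E.indicator (fun _ => Real.exp l - 1) ω := by
    funext ω
    by_cases hω : ω ∈ E <;> simp [hω]
  rw [mgf, hexp, integral_add (integrable_const _) ((integrable_const _).indicator hE),
    integral_indicator_const _ hE]
  simp

theorem mgf_indicator_one_le {E : Set Ω} (hE : MeasurableSet E) {l : ℝ} (hl : |l| ≤ 1) :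
    mgf (E.indicator 1) μ l ≤ Real.exp (μ.real E * (l + l ^ 2)) := by
  have hexp : Real.exp l - 1 ≤ l + l ^ 2 := by
    linarith [(abs_le.1 (Real.abs_exp_sub_one_sub_id_le hl)).2]
  calc mgf (E.indicator 1) μ l = 1 + μ.real E * (Real.exp l - 1) := mgf_indicator_one hE l
    _ ≤ μ.real E * (l + l ^ 2) + 1 := by
      linarith [mul_le_mul_of_nonneg_left hexp (measureReal_nonneg (μ := μ) (s := E))]
    _ ≤ _ := Real.add_one_le_exp _

variable {E : ι → Set Ω}

theorem integrable_exp_mul_sum_indicator (hE : ∀ i, MeasurableSet (E i)) (hind : iIndepSet E μ)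
    (T : Finset ι) (l : ℝ) :
    Integrable (fun ω => Real.exp (l * (∑ i ∈ T, (E i).indicator 1) ω)) μ := by
  refine hind.iIndepFun_indicator.integrable_exp_mul_sum
    (fun i => measurable_one.indicator (hE i)) fun i _ => ?_
  refine .of_bound (C := Real.exp |l|)
    ((measurable_one.indicator (hE i)).const_mul l).exp.aestronglyMeasurable
    (.of_forall fun ω => ?_)
  rw [Real.norm_eq_abs, Real.abs_exp, Real.exp_le_exp]
  by_cases hω : ω ∈ E i <;> simp [hω, le_abs_self]

theorem mgf_sum_indicator_le (hE : ∀ i, MeasurableSet (E i)) (hind : iIndepSet E μ)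
    (T : Finset ι) {l : ℝ} (hl : |l| ≤ 1) :
    mgf (∑ i ∈ T, (E i).indicator 1) μ l ≤
      Real.exp ((∑ i ∈ T, μ.real (E i)) * (l + l ^ 2)) := by
  have hmgf := hind.iIndepFun_indicator.mgf_sum (t := l)
    (fun i => measurable_one.indicator (hE i)) T
  calc mgf (∑ i ∈ T, (E i).indicator 1) μ l
      = ∏ i ∈ T, mgf ((E i).indicator 1) μ l := hmgf
    _ ≤ ∏ i ∈ T, Real.exp (μ.real (E i) * (l + l ^ 2)) :=
      prod_le_prod (fun _ _ => mgf_nonneg) fun i _ => mgf_indicator_one_le (hE i) hl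
    _ = _ := by rw [← Real.exp_sum, sum_mul]

/-- A two-sided Chernoff bound. The parameter `m` may exceed the mean, so the bound also applies
when the mean is too small to control the deviation. -/
theorem measureReal_lt_abs_sum_indicator_sub_le (hE : ∀ i, MeasurableSet (E i))
    (hind : iIndepSet E μ) (T : Finset ι) {δ m : ℝ} (hδ : 0 ≤ δ) (hδ' : δ ≤ 2)
    (hm : ∑ i ∈ T, μ.real (E i) ≤ m) :
    μ.real {ω | δ * m < |(∑ i ∈ T, (E i).indicator 1) ω - ∑ i ∈ T, μ.real (E i)|} ≤
      2 * Real.exp (-(δ ^ 2 * m / 4)) := by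
  set X : Ω → ℝ := ∑ i ∈ T, (E i).indicator 1
  set a := ∑ i ∈ T, μ.real (E i)
  have hl : |δ / 2| ≤ 1 := by rw [abs_of_nonneg (by positivity)]; linarith
  have hint := integrable_exp_mul_sum_indicator hE hind T
  have hexp : a * (δ / 2) ^ 2 - δ / 2 * (δ * m) ≤ -(δ ^ 2 * m / 4) := by
    nlinarith [mul_le_mul_of_nonneg_right hm (sq_nonneg (δ / 2))]
  have upper : μ.real {ω | a + δ * m ≤ X ω} ≤ Real.exp (-(δ ^ 2 * m / 4)) := by
    refine (measure_ge_le_exp_mul_mgf _ (by positivity) (hint (δ / 2))).trans ?_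
    refine (mul_le_mul_of_nonneg_left (mgf_sum_indicator_le hE hind T hl)
      (Real.exp_nonneg _)).trans ?_
    rw [← Real.exp_add, Real.exp_le_exp]
    linarith
  have lower : μ.real {ω | X ω ≤ a - δ * m} ≤ Real.exp (-(δ ^ 2 * m / 4)) := by
    refine (measure_le_le_exp_mul_mgf _ (by linarith) (hint (-(δ / 2)))).trans ?_
    refine (mul_le_mul_of_nonneg_left
      (mgf_sum_indicator_le hE hind T (by rwa [abs_neg])) (Real.exp_nonneg _)).trans ?_
    rw [← Real.exp_add, Real.exp_le_exp]
    linarith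
  have hsub : {ω | δ * m < |X ω - a|} ⊆ {ω | a + δ * m ≤ X ω} ∪ {ω | X ω ≤ a - δ * m} := by
    intro ω hω
    rcases lt_abs.1 (show δ * m < |X ω - a| from hω) with h | h
    · exact .inl (show a + δ * m ≤ X ω by linarith)
    · exact .inr (show X ω ≤ a - δ * m by linarith)
  linarith [(measureReal_mono (μ := μ) hsub).trans (measureReal_union_le _ _)]

end Chernoff

section ProductSpace

variable {V : Type*}

theorem dependsOn_mem_biInter {ι : Type*} [DecidableEq V] {A : V → Type*} {E : ι → Set (∀ v, A v)}
    {T : ι → Finset V} (S : Finset ι) (hE : ∀ i ∈ S, DependsOn (· ∈ E i) (T i)) :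
    DependsOn (· ∈ ⋂ i ∈ S, E i) (S.biUnion T) := by
  intro ω ω' h
  simp only [Set.mem_iInter₂]
  exact propext <| forall₂_congr fun i hi =>
    iff_of_eq (hE i hi fun x hx => h x (mem_biUnion.2 ⟨i, hi, hx⟩))

variable [Fintype V]

theorem measureReal_pi_inter_of_dependsOn {A : V → Type*} [∀ v, MeasurableSpace (A v)]
    (ν : ∀ v, Measure (A v)) [∀ v, IsProbabilityMeasure (ν v)] {S T : Finset V}
    (hST : Disjoint S T) {E F : Set (∀ v, A v)} (hE : MeasurableSet E) (hF : MeasurableSet F)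
    (hES : DependsOn (· ∈ E) S) (hFT : DependsOn (· ∈ F) T) :
    (Measure.pi ν).real (E ∩ F) = (Measure.pi ν).real E * (Measure.pi ν).real F := by
  classical
  have hind := (iIndepFun_pi (μ := ν) fun _ => aemeasurable_id).indepFun_finset S T hST
    fun v => measurable_pi_apply v
  rcases E.eq_empty_or_nonempty with rfl | ⟨ω₀, -⟩
  · simp
  let extend (U : Finset V) (y : ∀ v : U, A v) : ∀ v, A v :=
    fun v => if h : v ∈ U then y ⟨v, h⟩ else ω₀ v
  have measurable_extend (U : Finset V) : Measurable (extend U) := by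
    refine measurable_pi_lambda _ fun v => ?_
    by_cases h : v ∈ U
    · simpa only [extend, h, dif_pos] using measurable_pi_apply _
    · simpa only [extend, h, dif_neg, not_false_eq_true] using measurable_const
  have preimage_eq {U : Finset V} {D : Set (∀ v, A v)} (hD : DependsOn (· ∈ D) U) :
      (fun (ω : ∀ v, A v) (v : U) => ω v) ⁻¹' (extend U ⁻¹' D) = D := by
    ext ω
    exact iff_of_eq (hD fun v hv => dif_pos hv)
  have hmul := hind.measure_inter_preimage_eq_mul _ _ (measurable_extend S hE)
    (measurable_extend T hF)
  simp only [id, preimage_eq hES, preimage_eq hFT] at hmul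
  rw [measureReal_def, hmul, ENNReal.toReal_mul, measureReal_def, measureReal_def]

theorem measureReal_pi_lt_abs_card_sub_le {A : Type*} [MeasurableSpace A] (ν : Measure A)
    [IsProbabilityMeasure ν] {B : Set A} [DecidablePred (· ∈ B)] (hB : MeasurableSet B)
    (T : Finset V) {δ m : ℝ} (hδ : 0 ≤ δ) (hδ' : δ ≤ 2) (hm : ν.real B * #T ≤ m) :
    (Measure.pi fun _ : V => ν).real
        {ω | δ * m < |(#{x ∈ T | ω x ∈ B} : ℝ) - ν.real B * #T|} ≤
      2 * Real.exp (-(δ ^ 2 * m / 4)) := by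
  let E (x : V) : Set (V → A) := Function.eval x ⁻¹' B
  have hE (x : V) : MeasurableSet (E x) := measurable_pi_apply x hB
  have hprob (x : V) : (Measure.pi fun _ : V => ν).real (E x) = ν.real B := by
    rw [measureReal_def, (measurePreserving_eval (fun _ : V => ν) x).measure_preimage
      hB.nullMeasurableSet, measureReal_def]
  have hind : iIndepSet E (Measure.pi fun _ : V => ν) := by
    have h := iIndepFun_pi (μ := fun _ : V => ν) (X := fun _ => id) fun _ => aemeasurable_id
    exact (iIndepSet_iff_meas_biInter hE).2 fun S =>
      h.measure_inter_preimage_eq_mul S (sets := fun _ => B) fun _ _ => hB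
  have hsum : ∑ x ∈ T, (Measure.pi fun _ : V => ν).real (E x) = ν.real B * #T := by
    simp only [hprob, sum_const, nsmul_eq_mul, mul_comm]
  have hcard (ω : V → A) :
      (∑ x ∈ T, (E x).indicator (1 : (V → A) → ℝ)) ω = #{x ∈ T | ω x ∈ B} := by
    rw [Finset.sum_apply, card_filter, Nat.cast_sum]
    refine sum_congr rfl fun x _ => ?_
    by_cases h : ω x ∈ B <;> simp [E, h]
  have h := measureReal_lt_abs_sum_indicator_sub_le hE hind T hδ hδ' (hsum.trans_le hm)
  simpa only [hcard, hsum] using h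

end ProductSpace

section Schedule

variable {V : Type*} [DecidableEq V] {τ : V → ℕ} {S : Finset V} {u v w : V}

/-- `S` is a possible set of remaining vertices when vertices are removed in the order of their
removal times `τ`, with ties broken arbitrarily. -/
def IsRemaining (τ : V → ℕ) (S : Finset V) : Prop :=
  ∀ x ∉ S, ∀ y ∈ S, τ x ≤ τ y

theorem IsRemaining.erase (hS : IsRemaining τ S) (hmin : ∀ y ∈ S, τ u ≤ τ y) :
    IsRemaining τ (S.erase u) := by
  intro x hx y hy
  rcases eq_or_ne x u with rfl | hxu
  · exact hmin y (mem_of_mem_erase hy)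
  · exact hS x (fun h => hx (mem_erase.2 ⟨hxu, h⟩)) y (mem_of_mem_erase hy)

theorem card_sdiff_erase (T : Finset V) (hu : u ∈ S) :
    #(T \ S.erase u) = #(T \ S) + if u ∈ T then 1 else 0 := by
  split_ifs with huT
  · rw [sdiff_erase huT, card_insert_of_notMem fun h => (mem_sdiff.1 h).2 hu]
  · rw [erase_eq, sdiff_sdiff_right', inf_eq_inter, inter_singleton_of_notMem huT, sup_eq_union,
      union_empty, add_zero]

/-- The value at `v` when the vertices outside `S` have been removed, starting from the function
`f`, where `sav x` is the vertex saved by the removal of `x`, if any. -/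
def valueAfter [Fintype V] (G : SimpleGraph V) [DecidableRel G.Adj] (f : V → ℤ)
    (sav : V → Option V) (S : Finset V) (v : V) : ℤ :=
  f v - #(G.neighborFinset v \ S) + #(({x | sav x = some v} : Finset V) \ S)

variable [Fintype V] {G : SimpleGraph V} [DecidableRel G.Adj] {f : V → ℤ} {sav : V → Option V}

theorem valueAfter_erase (hu : u ∈ S) (v : V) :
    valueAfter G f sav (S.erase u) v = valueAfter G f sav S v - (if G.Adj u v then 1 else 0) +
      (if sav u = some v then 1 else 0) := by
  simp only [valueAfter, card_sdiff_erase _ hu, mem_neighborFinset, mem_filter_univ, G.adj_comm v u]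
  push_cast
  ring

theorem valueAfter_univ (f : V → ℤ) (sav : V → Option V) : valueAfter G f sav univ = f := by
  funext v
  simp [valueAfter, sdiff_eq_empty_iff_subset.2 (subset_univ _)]

theorem valueAfter_nonneg_of_degree_le_add_card_inter {m : ℕ}
    (h : G.degree v ≤ m + #(G.neighborFinset v ∩ S)) : 0 ≤ valueAfter G (fun _ => m) sav S v := by
  have hdeg : #(G.neighborFinset v \ S) + #(G.neighborFinset v ∩ S) = G.degree v :=
    card_sdiff_add_card_inter _ _
  simp only [valueAfter]
  lia

theorem valueAfter_nonneg_of_degree_le_add_card_fiber {m : ℕ}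
    (hadj : ∀ x, sav x = some v → G.Adj v x)
    (h : G.degree v ≤ m + #{x | sav x = some v}) : 0 ≤ valueAfter G (fun _ => m) sav S v := by
  have hinter : ({x | sav x = some v} : Finset V) ∩ S ⊆ G.neighborFinset v ∩ S := by
    refine inter_subset_inter_right fun x hx => ?_
    rw [mem_filter_univ] at hx
    exact (G.mem_neighborFinset v x).2 (hadj x hx)
  have hcard := card_le_card hinter
  have hfiber := card_sdiff_add_card_inter ({x | sav x = some v} : Finset V) S
  have hdeg : #(G.neighborFinset v \ S) + #(G.neighborFinset v ∩ S) = G.degree v :=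
    card_sdiff_add_card_inter _ _
  simp only [valueAfter]
  lia

theorem deleteFun_valueAfter (hu : u ∈ S) (hsav : sav u = none) :
    G.deleteFun (valueAfter G f sav S) u = valueAfter G f sav (S.erase u) := by
  funext v
  rw [valueAfter_erase hu, hsav, deleteFun]
  split_ifs <;> simp_all

theorem delSaveFun_valueAfter (hu : u ∈ S) (hsav : sav u = some w) (huw : G.Adj u w) :
    G.delSaveFun (valueAfter G f sav S) u w = valueAfter G f sav (S.erase u) := by
  funext v
  rw [valueAfter_erase hu, hsav, delSaveFun]
  rcases eq_or_ne v w with rfl | hv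
  · simp [huw]
  · by_cases huv : G.Adj u v <;> simp [hv, hv.symm, huv]

theorem removable_of_schedule (hadj : ∀ u w, sav u = some w → G.Adj u w ∧ τ u < τ w)
    (hnonneg : ∀ S, IsRemaining τ S → ∀ v ∈ S, 0 ≤ valueAfter G f sav S v)
    (hlt : ∀ S, IsRemaining τ S → ∀ u ∈ S, (∀ y ∈ S, τ u ≤ τ y) → ∀ w, sav u = some w →
      valueAfter G f sav S w < valueAfter G f sav S u)
    (hS : IsRemaining τ S) : G.Removable S (valueAfter G f sav S) := by
  induction S using Finset.strongInduction with
  | H S ih =>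
  rcases S.eq_empty_or_nonempty with rfl | hne
  · simpa using Removable.done _
  obtain ⟨u, hu, hmin⟩ := exists_min_image S τ hne
  have hrest := ih _ (erase_ssubset hu) (hS.erase hmin)
  have hnonneg' : ∀ v ∈ (S : Set V) \ {u}, 0 ≤ valueAfter G f sav (S.erase u) v :=
    fun v hv => hnonneg _ (hS.erase hmin) v (mem_erase.2 ⟨hv.2, hv.1⟩)
  rw [coe_erase] at hrest
  cases hsav : sav u with
  | none =>
    rw [← deleteFun_valueAfter hu hsav] at hrest hnonneg'
    exact .delete _ _ u hu hnonneg' hrest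
  | some w =>
    obtain ⟨huw, hτ⟩ := hadj u w hsav
    have hw : w ∈ S := by
      by_contra hw
      exact hτ.not_ge (hS w hw u hu)
    rw [← delSaveFun_valueAfter hu hsav huw] at hrest hnonneg'
    exact .delSave _ _ u w hu hw huw (hlt S hS u hu hmin w hsav) hnonneg' hrest

end Schedule

section Hall

variable {ι α : Type*} [Fintype ι] [DecidableEq α]

theorem exists_injective_sigma_of_mul_le_card {t : ι → Finset α} {n : ι → ℕ} {b : ℕ} (hb : 0 < b)
    (ht : ∀ i, n i * b ≤ #(t i)) (hu : ∀ u, #{i | 0 < n i ∧ u ∈ t i} ≤ b) :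
    ∃ e : (Σ i, Fin (n i)) → α, Function.Injective e ∧ ∀ x, e x ∈ t x.1 := by
  classical
  refine (all_card_le_biUnion_card_iff_exists_injective fun x : Σ i, Fin (n i) => t x.1).1
    fun X => Nat.le_of_mul_le_mul_right ?_ hb
  set U := X.biUnion fun x => t x.1
  set I := X.image Sigma.fst
  have hI {i : ι} (hi : i ∈ I) : 0 < n i ∧ t i ⊆ U := by
    obtain ⟨x, hx, rfl⟩ := mem_image.1 hi
    exact ⟨x.2.pos, subset_biUnion_of_mem (fun x => t x.1) hx⟩
  have hX : #X ≤ ∑ i ∈ I, n i := by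
    have hXI : X ⊆ I.sigma fun _ => univ :=
      fun x hx => mem_sigma.2 ⟨mem_image_of_mem _ hx, mem_univ _⟩
    simpa using card_le_card hXI
  calc #X * b ≤ ∑ i ∈ I, n i * b := by rw [← sum_mul]; gcongr
    _ ≤ ∑ i ∈ I, #{u ∈ U | u ∈ t i} := sum_le_sum fun i hi => by
      rw [filter_mem_eq_inter, inter_eq_right.2 (hI hi).2]
      exact ht i
    _ = ∑ u ∈ U, #{i ∈ I | u ∈ t i} :=
      sum_card_bipartiteAbove_eq_sum_card_bipartiteBelow fun i u => u ∈ t i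
    _ ≤ #U * b := sum_le_card_nsmul _ _ _ fun u _ => (card_le_card fun i hi => by
      rw [mem_filter] at hi
      simpa using ⟨(hI hi.1).1, hi.2⟩).trans (hu u)

theorem exists_assignment_card_fiber_eq [Fintype α] [DecidableEq ι] (t : ι → Finset α)
    (n : ι → ℕ) {b : ℕ} (hb : 0 < b) (ht : ∀ i, n i * b ≤ #(t i))
    (hu : ∀ u, #{i | 0 < n i ∧ u ∈ t i} ≤ b) :
    ∃ p : α → Option ι, (∀ u i, p u = some i → u ∈ t i) ∧ ∀ i, #{u | p u = some i} = n i := by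
  obtain ⟨e, he, het⟩ := exists_injective_sigma_of_mul_le_card hb ht hu
  have hp (u : α) (i : ι) :
      (Function.partialInv e u).map Sigma.fst = some i ↔ ∃ a, e ⟨i, a⟩ = u := by
    simp [Option.map_eq_some_iff, he.isPartialInv _ _]
  refine ⟨fun u => (Function.partialInv e u).map Sigma.fst, fun u i h => ?_, fun i => ?_⟩
  · obtain ⟨a, rfl⟩ := (hp u i).1 h
    exact het ⟨i, a⟩
  · have hfiber : ({u | (Function.partialInv e u).map Sigma.fst = some i} : Finset α) =
        univ.image fun a => e ⟨i, a⟩ := by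
      ext u
      simp [hp]
    rw [hfiber, card_image_of_injective univ (f := fun a => e ⟨i, a⟩)
      (he.comp sigma_mk_injective), card_univ, Fintype.card_fin]

end Hall

section UniformLabelling

variable {V A : Type*} [Fintype V] [MeasurableSpace A]

/-- The distribution of a labelling of `V` whose labels are independent and uniform in `A`. -/
noncomputable abbrev uniformLabelling (V A : Type*) [Fintype V] [MeasurableSpace A] :
    Measure (V → A) :=
  Measure.pi fun _ => uniformOn Set.univ

variable [MeasurableSingletonClass A]

instance isProbabilityMeasure_uniformOn_univ [Finite A] [Nonempty A] :
    IsProbabilityMeasure (uniformOn (Set.univ : Set A)) :=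
  isProbabilityMeasure_uniformOn Set.finite_univ Set.univ_nonempty

variable [Fintype A]

theorem measureReal_uniformOn_univ (B : Finset A) :
    (uniformOn Set.univ).real (B : Set A) = #B / Fintype.card A := by
  rw [measureReal_def, uniformOn_univ, Measure.count_apply_finset, ENNReal.toReal_div,
    ENNReal.toReal_natCast, ENNReal.toReal_natCast]

theorem uniformLabelling_lt_abs_card_sub_le [Nonempty A] [DecidableEq A] {B : Finset A} {q : ℝ}
    (hB : (#B : ℝ) = q * Fintype.card A) (T : Finset V) {δ m : ℝ} (hδ : 0 ≤ δ) (hδ' : δ ≤ 2)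
    (hm : q * #T ≤ m) :
    (uniformLabelling V A).real {ω | δ * m < |(#{x ∈ T | ω x ∈ B} : ℝ) - q * #T|} ≤
      2 * Real.exp (-(δ ^ 2 * m / 4)) := by
  have hq : (uniformOn Set.univ).real (B : Set A) = q := by
    rw [measureReal_uniformOn_univ, hB, mul_div_cancel_right₀]
    exact_mod_cast Fintype.card_ne_zero
  subst hq
  exact measureReal_pi_lt_abs_card_sub_le _ B.measurableSet T hδ hδ' hm

end UniformLabelling

section Label

/-- The random label `(m, y, h)` of a vertex: the vertex belongs to the reserve when `m = 0`,
which happens with probability `1 / M`, its phase is `y`, and `h` tells whether it belongs to the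
second half of that phase. -/
abbrev Label (k M : ℕ) : Type := Fin M × Fin k × Bool

variable {k M : ℕ} {a : Label k M}

/-- The labels of the vertices that are kept in reserve. -/
def reserve (k M : ℕ) [NeZero M] : Finset (Label k M) := {0} ×ˢ univ

/-- The labels whose phase precedes `j`. -/
def early (M : ℕ) (j : Fin k) : Finset (Label k M) := univ ×ˢ Iio j ×ˢ univ

/-- The labels in the first (`h = false`) or second (`h = true`) half of phase `j`. -/
def half (M : ℕ) (j : Fin k) (h : Bool) : Finset (Label k M) := univ ×ˢ {j} ×ˢ {h}

theorem mem_early {j : Fin k} : a ∈ early M j ↔ a.2.1 < j := by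
  simp only [early, mem_product, mem_univ, mem_Iio, true_and, and_true]

theorem mem_half {j : Fin k} {h : Bool} : a ∈ half M j h ↔ a.2.1 = j ∧ a.2.2 = h := by
  simp only [half, mem_product, mem_univ, mem_singleton, true_and]

theorem card_reserve_eq_mul [NeZero M] :
    (#(reserve k M) : ℝ) = 1 / M * Fintype.card (Label k M) := by
  simp [reserve, NeZero.ne]

variable [NeZero k]

theorem card_early_eq_mul (j : Fin k) :
    (#(early M j) : ℝ) = j / k * Fintype.card (Label k M) := by
  have hk : (k : ℝ) ≠ 0 := NeZero.ne _
  simp only [early, card_product, Fintype.card_prod, card_univ, Fintype.card_fin, Fin.card_Iio,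
    Fintype.card_bool]
  push_cast
  field_simp

theorem card_half_eq_mul (j : Fin k) (h : Bool) :
    (#(half M j h) : ℝ) = 1 / (2 * k) * Fintype.card (Label k M) := by
  have hk : (k : ℝ) ≠ 0 := NeZero.ne _
  simp only [half, card_product, Fintype.card_prod, card_univ, Fintype.card_fin, card_singleton,
    Fintype.card_bool]
  push_cast
  field_simp

end Label

section Balanced

variable {V : Type*} [Fintype V] {G : SimpleGraph V} [DecidableRel G.Adj] {k M : ℕ} [NeZero M]
  {col : V → Fin k} {d : ℕ} {v : V} {ω ω' : V → Label k M}

/-- The neighbors of `v` of color `j`. -/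
def colorNeighbors (G : SimpleGraph V) [DecidableRel G.Adj] (col : V → Fin k) (v : V) (j : Fin k) :
    Finset V :=
  {x ∈ G.neighborFinset v | col x = j}

theorem colorNeighbors_subset (G : SimpleGraph V) [DecidableRel G.Adj] (col : V → Fin k) (v : V)
    (j : Fin k) : colorNeighbors G col v j ⊆ G.neighborFinset v :=
  filter_subset _ _

/-- The numbers of neighbors of `v` in the reserve, with phase before `j`, and with color `j` in
either half of phase `j`, are all close to their expectations under a uniform labelling. -/
structure BalancedAt (G : SimpleGraph V) [DecidableRel G.Adj] (col : V → Fin k) (d : ℕ) (v : V)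
    (ω : V → Label k M) : Prop where
  card_reserve : |(#{x ∈ G.neighborFinset v | ω x ∈ reserve k M} : ℝ) - 1 / M * G.degree v| ≤
    1 / 4 * (d / M)
  card_early (j : Fin k) :
    |(#{x ∈ G.neighborFinset v | ω x ∈ early M j} : ℝ) - j / k * G.degree v| ≤ 1 / (32 * k ^ 2) * d
  card_half (j : Fin k) (h : Bool) : |(#{x ∈ colorNeighbors G col v j | ω x ∈ half M j h} : ℝ) -
    1 / (2 * k) * #(colorNeighbors G col v j)| ≤ 1 / (32 * k ^ 2) * d

theorem BalancedAt.congr (hω : BalancedAt G col d v ω) (h : ∀ x ∈ G.neighborFinset v, ω x = ω' x) :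
    BalancedAt G col d v ω' := by
  have key {T : Finset V} (hT : T ⊆ G.neighborFinset v) (B : Finset (Label k M)) :
      #{x ∈ T | ω' x ∈ B} = #{x ∈ T | ω x ∈ B} :=
    congrArg card (filter_congr fun x hx => by rw [h x (hT hx)])
  refine ⟨?_, fun j => ?_, fun j b => ?_⟩
  · rw [key Subset.rfl]
    exact hω.card_reserve
  · rw [key Subset.rfl]
    exact hω.card_early j
  · rw [key (colorNeighbors_subset G col v j)]
    exact hω.card_half j b

theorem dependsOn_balancedAt (G : SimpleGraph V) [DecidableRel G.Adj] (col : V → Fin k) (d : ℕ)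
    (v : V) : DependsOn (fun ω : V → Label k M => BalancedAt G col d v ω) (G.neighborFinset v) :=
  fun _ _ h => propext ⟨fun hω => hω.congr h, fun hω => hω.congr fun x hx => (h x hx).symm⟩

theorem uniformLabelling_reserve_deviation_le [NeZero k] (hMd : M ^ 2 ≤ d) {T : Finset V}
    (hT : #T ≤ d) :
    (uniformLabelling V (Label k M)).real
        {ω | 1 / 4 * (d / M) < |(#{x ∈ T | ω x ∈ reserve k M} : ℝ) - 1 / M * #T|} ≤
      2 * Real.exp (-(M / 64)) := by
  have hM : (0 : ℝ) < M := by exact_mod_cast NeZero.pos M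
  have hmean : 1 / M * #T ≤ (d / M : ℝ) := by
    rw [one_div_mul_eq_div]
    gcongr
  have hexp : (M : ℝ) / 64 ≤ (1 / 4) ^ 2 * (d / M) / 4 := by
    have : (M : ℝ) ≤ d / M := (le_div_iff₀ hM).2 (by exact_mod_cast sq M ▸ hMd)
    linarith
  exact (uniformLabelling_lt_abs_card_sub_le card_reserve_eq_mul T (by norm_num) (by norm_num)
    hmean).trans (by gcongr)

theorem uniformLabelling_phase_deviation_le [NeZero k] (hM : 64 * k ^ 4 ≤ M) (hMd : M ^ 2 ≤ d)
    {B : Finset (Label k M)} {q : ℝ} (hB : (#B : ℝ) = q * Fintype.card (Label k M)) {T : Finset V}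
    (hT : #T ≤ d) :
    (uniformLabelling V (Label k M)).real
        {ω | 1 / (32 * k ^ 2) * d < |(#{x ∈ T | ω x ∈ B} : ℝ) - q * #T|} ≤
      2 * Real.exp (-(M / 64)) := by
  have hk : (1 : ℝ) ≤ k := by exact_mod_cast NeZero.one_le
  have hq : q ≤ 1 := by
    refine le_of_mul_le_mul_right (a := (Fintype.card (Label k M) : ℝ)) ?_
      (by exact_mod_cast Fintype.card_pos)
    rw [← hB, one_mul]
    exact_mod_cast card_le_univ B
  have hmean : q * #T ≤ d :=
    (mul_le_of_le_one_left (Nat.cast_nonneg _) hq).trans (by exact_mod_cast hT)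
  have hdev : 1 / (32 * k ^ 2) ≤ (2 : ℝ) := by
    rw [div_le_iff₀ (by positivity)]
    nlinarith
  have hexp : (M : ℝ) / 64 ≤ (1 / (32 * k ^ 2)) ^ 2 * d / 4 := by
    have : (64 * k ^ 4 * M : ℝ) ≤ d := by
      exact_mod_cast (Nat.mul_le_mul_right M hM).trans (sq M ▸ hMd)
    field_simp
    linarith
  exact (uniformLabelling_lt_abs_card_sub_le hB T (by positivity) hdev hmean).trans (by gcongr)

theorem uniformLabelling_not_balancedAt_le [NeZero k] (hM : 64 * k ^ 4 ≤ M) (hMd : M ^ 2 ≤ d)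
    (hd : G.degree v ≤ d) :
    (uniformLabelling V (Label k M)).real {ω | ¬ BalancedAt G col d v ω} ≤
      (6 * k + 2) * Real.exp (-(M / 64)) := by
  set μ := uniformLabelling V (Label k M)
  let R : Set (V → Label k M) := {ω | 1 / 4 * (d / M) <
    |(#{x ∈ G.neighborFinset v | ω x ∈ reserve k M} : ℝ) - 1 / M * G.degree v|}
  let E (j : Fin k) : Set (V → Label k M) := {ω | 1 / (32 * k ^ 2) * d <
    |(#{x ∈ G.neighborFinset v | ω x ∈ early M j} : ℝ) - j / k * G.degree v|}
  let H (p : Fin k × Bool) : Set (V → Label k M) := {ω | 1 / (32 * k ^ 2) * d <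
    |(#{x ∈ colorNeighbors G col v p.1 | ω x ∈ half M p.1 p.2} : ℝ) -
      1 / (2 * k) * #(colorNeighbors G col v p.1)|}
  have hcover : {ω | ¬ BalancedAt G col d v ω} ⊆ R ∪ ((⋃ j, E j) ∪ ⋃ p, H p) := by
    intro ω hω
    by_contra! h
    simp only [R, E, H, Set.mem_union, Set.mem_iUnion, Set.mem_ofPred, not_or, not_exists,
      not_lt] at h
    exact hω ⟨h.1, h.2.1, fun j b => h.2.2 (j, b)⟩
  have hE : μ.real (⋃ j, E j) ≤ ∑ _j : Fin k, 2 * Real.exp (-(M / 64)) :=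
    (measureReal_iUnion_fintype_le _).trans <| sum_le_sum fun j _ =>
      uniformLabelling_phase_deviation_le hM hMd (card_early_eq_mul j) hd
  have hH : μ.real (⋃ p, H p) ≤ ∑ _p : Fin k × Bool, 2 * Real.exp (-(M / 64)) :=
    (measureReal_iUnion_fintype_le _).trans <| sum_le_sum fun p _ =>
      uniformLabelling_phase_deviation_le hM hMd (card_half_eq_mul p.1 p.2)
        ((card_le_card (colorNeighbors_subset G col v p.1)).trans hd)
  calc μ.real {ω | ¬ BalancedAt G col d v ω}
      ≤ μ.real R + (μ.real (⋃ j, E j) + μ.real (⋃ p, H p)) :=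
        (measureReal_mono hcover).trans <| (measureReal_union_le _ _).trans <|
          add_le_add_right (measureReal_union_le _ _) _
    _ ≤ 2 * Real.exp (-(M / 64)) + (∑ _j : Fin k, 2 * Real.exp (-(M / 64)) +
        ∑ _p : Fin k × Bool, 2 * Real.exp (-(M / 64))) :=
      add_le_add (uniformLabelling_reserve_deviation_le hMd hd) (add_le_add hE hH)
    _ = (6 * k + 2) * Real.exp (-(M / 64)) := by
      simp only [sum_const, card_univ, Fintype.card_fin, Fintype.card_prod, Fintype.card_bool,
        nsmul_eq_mul, Nat.cast_mul, Nat.cast_ofNat]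
      ring

theorem card_common_neighbor_le [DecidableEq V] (hd : ∀ v, G.degree v ≤ d) (v : V) :
    #{w | ¬ Disjoint (G.neighborFinset v) (G.neighborFinset w)} ≤ d ^ 2 := by
  have hsub : ({w | ¬ Disjoint (G.neighborFinset v) (G.neighborFinset w)} : Finset V) ⊆
      (G.neighborFinset v).biUnion fun x => G.neighborFinset x := by
    intro w hw
    obtain ⟨x, hvx, hwx⟩ := not_disjoint_iff.1 (mem_filter.1 hw).2
    rw [mem_neighborFinset] at hwx
    exact mem_biUnion.2 ⟨x, hvx, (G.mem_neighborFinset x w).2 hwx.symm⟩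
  calc _ ≤ #((G.neighborFinset v).biUnion fun x => G.neighborFinset x) := card_le_card hsub
    _ ≤ #(G.neighborFinset v) * d := card_biUnion_le_card_mul _ _ _ fun x _ => hd x
    _ ≤ d ^ 2 := by rw [sq]; exact Nat.mul_le_mul_right _ (hd v)

theorem exists_forall_balancedAt [NeZero k] (col : V → Fin k) (hM : 64 * k ^ 4 ≤ M)
    (hMd : M ^ 2 ≤ d) (hd : ∀ v, G.degree v ≤ d)
    (hexp : 4 * ((6 * k + 2) * Real.exp (-(M / 64))) * d ^ 2 ≤ 1) :
    ∃ ω : V → Label k M, ∀ v, BalancedAt G col d v ω := by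
  classical
  set p : ℝ := (6 * k + 2) * Real.exp (-(M / 64))
  let A (v : V) : Set (V → Label k M) := {ω | ¬ BalancedAt G col d v ω}
  let N (v : V) : Finset V := {w | ¬ Disjoint (G.neighborFinset v) (G.neighborFinset w)}
  have hp : 0 ≤ p := by positivity
  have hd1 : (1 : ℝ) ≤ d ^ 2 := by
    have : 0 < d := (pow_pos (NeZero.pos M) 2).trans_le hMd
    exact_mod_cast Nat.one_le_pow _ _ this
  have hpN (v : V) : 4 * p * #(N v) ≤ 1 :=
    (mul_le_mul_of_nonneg_left (by exact_mod_cast card_common_neighbor_le hd v)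
      (by positivity)).trans hexp
  have hA (v : V) (S : Finset V) (hS : Disjoint S (N v)) :
      (uniformLabelling V (Label k M)).real (A v ∩ ⋂ w ∈ S, (A w)ᶜ) ≤
        p * (uniformLabelling V (Label k M)).real (⋂ w ∈ S, (A w)ᶜ) := by
    have hdisj : Disjoint (G.neighborFinset v) (S.biUnion fun w => G.neighborFinset w) := by
      rw [disjoint_biUnion_right]
      intro w hw
      simpa [N] using Finset.disjoint_left.1 hS hw
    have hv : DependsOn (· ∈ A v) (G.neighborFinset v) := fun _ _ h =>
      congrArg Not (dependsOn_balancedAt G col d v h)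
    have hinter : DependsOn (· ∈ ⋂ w ∈ S, (A w)ᶜ) (S.biUnion fun w => G.neighborFinset w) :=
      dependsOn_mem_biInter S fun w _ _ _ h =>
        congrArg Not (congrArg Not (dependsOn_balancedAt G col d w h))
    rw [measureReal_pi_inter_of_dependsOn _ hdisj .of_discrete .of_discrete hv hinter]
    exact mul_le_mul_of_nonneg_right (uniformLabelling_not_balancedAt_le hM hMd (hd v))
      measureReal_nonneg
  have hpos := measureReal_biInter_compl_pos hp (by nlinarith) hpN hA univ
  obtain ⟨ω, hω⟩ := nonempty_of_measureReal_ne_zero hpos.ne'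
  exact ⟨ω, fun v => not_not.1 (Set.mem_iInter₂.1 hω v (mem_univ v))⟩

end Balanced

section Parameters

variable {k M d s : ℕ} [NeZero k]

theorem two_mul_div_le_of_mul_pow_le (hM : 64 * k ^ 4 ≤ M) :
    2 * (d / M : ℝ) ≤ 1 / (32 * k ^ 2) * d := by
  have hk : (0 : ℝ) < k := by exact_mod_cast NeZero.pos k
  have hM' : (64 * k ^ 2 : ℝ) ≤ M := by
    exact_mod_cast (Nat.mul_le_mul_left 64 (Nat.pow_le_pow_right (NeZero.pos k)
      (by norm_num : 2 ≤ 4))).trans hM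
  calc 2 * (d / M : ℝ) ≤ 2 * (d / (64 * k ^ 2)) := by gcongr
    _ = 1 / (32 * k ^ 2) * d := by ring

theorem lt_one_div_mul_of_mul_le (hM : 64 * k ^ 4 ≤ M) (hMd : M ^ 2 ≤ d)
    (hs : 16 * k ^ 2 * s ≤ M) : (s : ℝ) < 1 / (32 * k ^ 2) * d := by
  have hk : (0 : ℝ) < k := by exact_mod_cast NeZero.pos k
  have hlt : (32 * k ^ 2 * s : ℝ) < d := by
    have : 1 ≤ k ^ 4 := Nat.one_le_pow _ _ (NeZero.pos k)
    exact_mod_cast (by nlinarith : 32 * k ^ 2 * s < d)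
  rw [one_div_mul_eq_div, lt_div_iff₀ (by positivity)]
  linarith

theorem two_mul_le_of_mul_le (hM : 64 * k ^ 4 ≤ M) (hMd : M ^ 2 ≤ d)
    (hs : 16 * k ^ 2 * s ≤ M) : 2 * s ≤ d := by
  have : 1 ≤ k ^ 4 := Nat.one_le_pow _ _ (NeZero.pos k)
  have : 1 ≤ k ^ 2 := Nat.one_le_pow _ _ (NeZero.pos k)
  nlinarith

theorem le_one_fourth_mul_div [NeZero M] (hMd : M ^ 2 ≤ d) (hs : 16 * k ^ 2 * s ≤ M) :
    (s : ℝ) ≤ 1 / 4 * (d / M) := by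
  have hM : (0 : ℝ) < M := by exact_mod_cast NeZero.pos M
  have hsM : (4 * s : ℝ) ≤ M := by
    have : 1 ≤ k ^ 2 := Nat.one_le_pow _ _ (NeZero.pos k)
    exact_mod_cast (by nlinarith : 4 * s ≤ M)
  have hMdM : (M : ℝ) ≤ d / M := by
    rw [le_div_iff₀ hM, ← sq]
    exact_mod_cast hMd
  linarith

theorem mul_two_mul_div_le [NeZero M] (hs : 16 * k ^ 2 * s ≤ M) :
    (s * (2 * d / M : ℕ) : ℝ) ≤ 4 * (1 / (32 * k ^ 2) * d) := by
  have hk : (0 : ℝ) < k := by exact_mod_cast NeZero.pos k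
  have hM : (0 : ℝ) < M := by exact_mod_cast NeZero.pos M
  have hs' : (s : ℝ) ≤ M / (16 * k ^ 2) := by
    rw [le_div_iff₀' (by positivity)]
    exact_mod_cast hs
  calc (s * (2 * d / M : ℕ) : ℝ) ≤ M / (16 * k ^ 2) * (2 * d / M) := by
        gcongr
        exact_mod_cast Nat.cast_div_le (α := ℝ) (m := 2 * d) (n := M)
    _ = 4 * (1 / (32 * k ^ 2) * d) := by field_simp; ring

end Parameters

section Savers

variable {V : Type*} [Fintype V] {G : SimpleGraph V} [DecidableRel G.Adj] {k M : ℕ} [NeZero M]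
  {col : V → Fin k} {d s : ℕ} {u v w : V} {j : Fin k} {h : Bool} {ω : V → Label k M}

theorem exists_degree_div_le_card_colorNeighbors [NeZero k] (G : SimpleGraph V)
    [DecidableRel G.Adj] (col : V → Fin k) (v : V) :
    ∃ j, (G.degree v / k : ℝ) ≤ #(colorNeighbors G col v j) := by
  have hk : (k : ℝ) ≠ 0 := NeZero.ne _
  obtain ⟨j, -, hj⟩ := exists_le_card_fiber_of_nsmul_le_card_of_maps_to
    (s := G.neighborFinset v) (t := univ) (f := col) (b := (G.degree v / k : ℝ))
    (fun _ _ => mem_univ _) univ_nonempty (by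
      rw [card_univ, Fintype.card_fin, nsmul_eq_mul, mul_div_cancel₀ _ hk]
      exact le_rfl)
  exact ⟨j, hj⟩

theorem BalancedAt.card_reserve_le (hω : BalancedAt G col d v ω) (hd : G.degree v ≤ d) :
    (#{x ∈ G.neighborFinset v | ω x ∈ reserve k M} : ℝ) ≤ 2 * (d / M) := by
  have hmean : 1 / M * G.degree v ≤ (d / M : ℝ) := by
    rw [one_div_mul_eq_div]
    gcongr
  have : (0 : ℝ) ≤ d / M := by positivity
  linarith [(abs_le.1 hω.card_reserve).2]

theorem BalancedAt.le_card_reserve (hω : BalancedAt G col d v ω) (hd : d ≤ 2 * G.degree v) :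
    1 / 4 * (d / M) ≤ (#{x ∈ G.neighborFinset v | ω x ∈ reserve k M} : ℝ) := by
  have hmean : 1 / 2 * (d / M) ≤ 1 / M * (G.degree v : ℝ) := by
    have hd' : (d : ℝ) ≤ 2 * G.degree v := by exact_mod_cast hd
    calc 1 / 2 * (d / M) ≤ 1 / 2 * (2 * G.degree v / M : ℝ) := by gcongr
      _ = 1 / M * G.degree v := by ring
  linarith [(abs_le.1 hω.card_reserve).1]

theorem BalancedAt.le_card_half (hω : BalancedAt G col d v ω)
    (hd : d ≤ 2 * G.degree v) (hj : (G.degree v / k : ℝ) ≤ #(colorNeighbors G col v j)) :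
    7 * (1 / (32 * k ^ 2) * d) ≤ (#{x ∈ colorNeighbors G col v j | ω x ∈ half M j h} : ℝ) := by
  have hmean : 8 * (1 / (32 * k ^ 2) * d) ≤ (1 / (2 * k) * #(colorNeighbors G col v j) : ℝ) := by
    have hd' : (d : ℝ) ≤ 2 * G.degree v := by exact_mod_cast hd
    calc 8 * (1 / (32 * k ^ 2) * d) ≤ (8 * (1 / (32 * k ^ 2) * (2 * G.degree v)) : ℝ) := by gcongr
      _ = 1 / (2 * k) * (G.degree v / k) := by field_simp; norm_num
      _ ≤ 1 / (2 * k) * #(colorNeighbors G col v j) := by gcongr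
  linarith [(abs_le.1 (hω.card_half j h)).1]

/-- The potential savers of `w`: its neighbors of color `j` in the second half of phase `j` that
are not in the reserve. -/
def savers (G : SimpleGraph V) [DecidableRel G.Adj] (col : V → Fin k) (ω : V → Label k M)
    (j : Fin k) (w : V) : Finset V :=
  {x ∈ colorNeighbors G col w j | ω x ∈ half M j true \ reserve k M}

theorem mem_savers : u ∈ savers G col ω j w ↔
    G.Adj w u ∧ col u = j ∧ ω u ∈ half M j true ∧ ω u ∉ reserve k M := by
  simp only [savers, colorNeighbors, mem_filter, mem_neighborFinset, mem_sdiff, and_assoc]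

theorem card_half_le_card_savers_add_card_reserve (G : SimpleGraph V) [DecidableRel G.Adj]
    (col : V → Fin k) (ω : V → Label k M) (j : Fin k) (w : V) :
    #{x ∈ colorNeighbors G col w j | ω x ∈ half M j true} ≤
      #(savers G col ω j w) + #{x ∈ G.neighborFinset w | ω x ∈ reserve k M} := by
  classical
  refine (card_le_card fun x hx => ?_).trans (card_union_le _ _)
  rw [mem_filter] at hx
  by_cases hres : ω x ∈ reserve k M
  · exact mem_union_right _ (mem_filter.2 ⟨colorNeighbors_subset G col w j hx.1, hres⟩)
  · exact mem_union_left _ (mem_filter.2 ⟨hx.1, mem_sdiff.2 ⟨hx.2, hres⟩⟩)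

theorem BalancedAt.le_card_savers [NeZero k] (hω : BalancedAt G col d w ω) (hM : 64 * k ^ 4 ≤ M)
    (hd : G.degree w ≤ d) (hd' : d ≤ 2 * G.degree w)
    (hj : (G.degree w / k : ℝ) ≤ #(colorNeighbors G col w j)) :
    6 * (1 / (32 * k ^ 2) * d) ≤ (#(savers G col ω j w) : ℝ) := by
  have hsplit : (#{x ∈ colorNeighbors G col w j | ω x ∈ half M j true} : ℝ) ≤
      #(savers G col ω j w) + #{x ∈ G.neighborFinset w | ω x ∈ reserve k M} := by
    exact_mod_cast card_half_le_card_savers_add_card_reserve G col ω j w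
  linarith [hω.le_card_half (h := true) hd' hj, hω.card_reserve_le hd,
    two_mul_div_le_of_mul_pow_le (k := k) (d := d) hM]

theorem BalancedAt.card_early_add_lt [NeZero k] (hu : BalancedAt G col d u ω)
    (hw : BalancedAt G col d w ω) (hM : 64 * k ^ 4 ≤ M) (hMd : M ^ 2 ≤ d)
    (hs : 16 * k ^ 2 * s ≤ M) (hd : ∀ v, G.degree v ≤ d) (hdw : d < G.degree w + s)
    (hdw' : d ≤ 2 * G.degree w)
    (hj : (G.degree w / k : ℝ) ≤ #(colorNeighbors G col w j)) :
    #{x ∈ G.neighborFinset u | ω x ∈ early M j} + s +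
        #{x ∈ G.neighborFinset w | ω x ∈ reserve k M} <
      #{x ∈ G.neighborFinset w | ω x ∈ early M j} +
        #{x ∈ colorNeighbors G col w j | ω x ∈ half M j false} := by
  have hk : (0 : ℝ) < k := by exact_mod_cast NeZero.pos k
  have hmean : (j / k : ℝ) * G.degree u ≤ j / k * G.degree w + s := by
    have hjk : (j / k : ℝ) ≤ 1 := (div_le_one hk).2 (by exact_mod_cast j.2.le)
    have hdeg : (G.degree u : ℝ) ≤ G.degree w + s := by exact_mod_cast (hd u).trans hdw.le
    calc (j / k : ℝ) * G.degree u ≤ j / k * (G.degree w + s) := by gcongr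
      _ = j / k * G.degree w + j / k * s := mul_add _ _ _
      _ ≤ _ := by gcongr; exact mul_le_of_le_one_left (Nat.cast_nonneg _) hjk
  rw [← Nat.cast_lt (α := ℝ)]
  push_cast
  linarith [(abs_le.1 (hu.card_early j)).2, (abs_le.1 (hw.card_early j)).1,
    hw.le_card_half (h := false) hdw' hj, hw.card_reserve_le (hd w),
    two_mul_div_le_of_mul_pow_le (k := k) (d := d) hM, lt_one_div_mul_of_mul_le hM hMd hs]

end Savers

section Removal

variable {V : Type*} {k M : ℕ} [NeZero M] {col : V → Fin k} {ω : V → Label k M} {u v w x : V}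
  {j : Fin k}

/-- The time at which the vertex `v` is removed. Each phase has three consecutive steps: the
vertices whose color is the phase come first, the two halves one after the other, followed by the
vertices of other colors. The reserve is removed after the last phase. -/
def removalTime (col : V → Fin k) (ω : V → Label k M) (v : V) : ℕ :=
  if ω v ∈ reserve k M then 3 * k
  else if col v = (ω v).2.1 then 3 * (ω v).2.1 + (ω v).2.2.toNat
  else 3 * (ω v).2.1 + 2

theorem removalTime_of_mem_reserve (h : ω v ∈ reserve k M) : removalTime col ω v = 3 * k :=
  if_pos h

theorem removalTime_lt_of_notMem_reserve (h : ω v ∉ reserve k M) :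
    removalTime col ω v < 3 * k := by
  have := (ω v).2.1.2
  have := (ω v).2.2.toNat_le
  simp only [removalTime, h, if_false]
  split_ifs <;> lia

theorem removalTime_of_mem_half {b : Bool} (h : ω v ∉ reserve k M) (hcol : col v = j)
    (hv : ω v ∈ half M j b) : removalTime col ω v = 3 * j + b.toNat := by
  obtain ⟨hphase, hhalf⟩ := mem_half.1 hv
  simp [removalTime, h, hcol, hphase, hhalf]

theorem removalTime_lt_of_mem_early (h : ω v ∉ reserve k M) (hv : ω v ∈ early M j) :
    removalTime col ω v < 3 * j := by
  have := Fin.lt_def.1 (mem_early.1 hv)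
  have := (ω v).2.2.toNat_le
  simp only [removalTime, h, if_false]
  split_ifs <;> lia

theorem mem_early_of_removalTime_le (hcol : col v ≠ j) (h : removalTime col ω v ≤ 3 * j + 1) :
    ω v ∈ early M j := by
  rw [mem_early, Fin.lt_def]
  by_contra! hlt
  have := j.2
  have : col v = (ω v).2.1 → (ω v).2.1.val ≠ j := fun h₁ h₂ => hcol (h₁.trans (Fin.ext h₂))
  simp only [removalTime] at h
  split_ifs at h <;> grind

variable [Fintype V] {G : SimpleGraph V} [DecidableRel G.Adj] {d s m : ℕ}

/-- The number of vertices that must save `w` when the initial values are all `m`. Only reserve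
vertices are saved. -/
def demand (G : SimpleGraph V) [DecidableRel G.Adj] (ω : V → Label k M) (m : ℕ) (w : V) : ℕ :=
  if ω w ∈ reserve k M then G.degree w - m else 0

theorem demand_pos : 0 < demand G ω m w ↔ ω w ∈ reserve k M ∧ m < G.degree w := by
  rw [demand]
  split_ifs with h <;> simp [h]

theorem demand_le (hd : G.degree w ≤ d) : demand G ω (d - s) w ≤ s := by
  rw [demand]
  split_ifs <;> lia

section SaverAssignment

variable [DecidableEq V] {sav : V → Option V} {S : Finset V}

theorem exists_saver_assignment [NeZero k] (hM : 64 * k ^ 4 ≤ M) (hMd : M ^ 2 ≤ d)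
    (hs : 16 * k ^ 2 * s ≤ M) (hd : ∀ v, G.degree v ≤ d) (hω : ∀ v, BalancedAt G col d v ω)
    {j : V → Fin k} (hj : ∀ v, (G.degree v / k : ℝ) ≤ #(colorNeighbors G col v (j v))) :
    ∃ sav : V → Option V, (∀ u w, sav u = some w → u ∈ savers G col ω (j w) w) ∧
      ∀ w, #{u | sav u = some w} = demand G ω (d - s) w := by
  have hMpos : 0 < M := NeZero.pos M
  have hMd' : M ≤ d := (Nat.le_self_pow two_ne_zero M).trans hMd
  refine exists_assignment_card_fiber_eq (fun w => savers G col ω (j w) w) (demand G ω (d - s))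
    (b := 2 * d / M) (Nat.div_pos (by lia) hMpos) (fun w => ?_) fun u => ?_
  · rcases (demand G ω (d - s) w).eq_zero_or_pos with hzero | hpos
    · simp [hzero]
    have hdeg : d ≤ 2 * G.degree w := by
      have := two_mul_le_of_mul_le hM hMd hs
      have := (demand_pos.1 hpos).2
      lia
    have hnonneg : (0 : ℝ) ≤ 1 / (32 * k ^ 2) * d := by positivity
    refine (Nat.mul_le_mul_right _ (demand_le (hd w))).trans ?_
    rw [← Nat.cast_le (α := ℝ), Nat.cast_mul]
    linarith [hnonneg, mul_two_mul_div_le (d := d) hs,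
      (hω w).le_card_savers hM (hd w) hdeg (hj w)]
  · have hsub : ({w | 0 < demand G ω (d - s) w ∧ u ∈ savers G col ω (j w) w} : Finset V) ⊆
        {w ∈ G.neighborFinset u | ω w ∈ reserve k M} := by
      intro w hw
      obtain ⟨hpos, hmem⟩ := (mem_filter.1 hw).2
      exact mem_filter.2 ⟨(G.mem_neighborFinset u w).2 (mem_savers.1 hmem).1.symm,
        (demand_pos.1 hpos).1⟩
    refine (card_le_card hsub).trans ((Nat.le_div_iff_mul_le hMpos).2 ?_)
    have hle := (hω u).card_reserve_le (hd u)
    rw [← mul_div_assoc, le_div_iff₀ (by exact_mod_cast hMpos)] at hle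
    exact_mod_cast hle

theorem mem_reserve_of_sav_eq_some (hdemand : ∀ w, #{u | sav u = some w} = demand G ω m w)
    (h : sav u = some w) : ω w ∈ reserve k M ∧ m < G.degree w :=
  demand_pos.1 (hdemand w ▸ card_pos.2 ⟨u, (mem_filter_univ u).2 h⟩)

theorem reserve_neighbors_subset (hS : IsRemaining (removalTime col ω) S) (hv : v ∈ S)
    (hres : ω v ∉ reserve k M) :
    {x ∈ G.neighborFinset v | ω x ∈ reserve k M} ⊆ G.neighborFinset v ∩ S := by
  intro x hx
  rw [mem_filter] at hx
  refine mem_inter.2 ⟨hx.1, ?_⟩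
  by_contra hxS
  have hle := hS x hxS v hv
  rw [removalTime_of_mem_reserve hx.2] at hle
  exact hle.not_gt (removalTime_lt_of_notMem_reserve hres)

theorem removed_neighbors_subset_early (C : G.Coloring (Fin k))
    (hS : IsRemaining (removalTime C ω) S) (hu : u ∈ S) (hcol : C u = j)
    (htime : removalTime C ω u = 3 * j + 1) :
    G.neighborFinset u \ S ⊆ {x ∈ G.neighborFinset u | ω x ∈ early M j} := by
  intro x hx
  obtain ⟨hux, hxS⟩ := mem_sdiff.1 hx
  refine mem_filter.2 ⟨hux, mem_early_of_removalTime_le ?_ (htime ▸ hS x hxS u hu)⟩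
  exact hcol ▸ (C.valid ((G.mem_neighborFinset u x).1 hux)).symm

theorem card_early_add_card_half_le (hS : ∀ y ∈ S, 3 * j + 1 ≤ removalTime col ω y) (w : V) :
    #{x ∈ G.neighborFinset w | ω x ∈ early M j} +
        #{x ∈ colorNeighbors G col w j | ω x ∈ half M j false} ≤
      #(G.neighborFinset w \ S) + #{x ∈ G.neighborFinset w | ω x ∈ reserve k M} := by
  have hdisj : Disjoint {x ∈ G.neighborFinset w | ω x ∈ early M j}
      {x ∈ colorNeighbors G col w j | ω x ∈ half M j false} := by
    rw [Finset.disjoint_left]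
    intro x hx hx'
    exact (mem_early.1 (mem_filter.1 hx).2).ne (mem_half.1 (mem_filter.1 hx').2).1
  rw [← card_union_of_disjoint hdisj]
  refine (card_le_card fun x hx => ?_).trans (card_union_le _ _)
  simp only [mem_union, mem_filter, mem_sdiff, colorNeighbors] at hx ⊢
  have hwx : x ∈ G.neighborFinset w := hx.elim And.left fun hx => hx.1.1
  by_cases hres : ω x ∈ reserve k M
  · exact .inr ⟨hwx, hres⟩
  · refine .inl ⟨hwx, fun hxS => (hS x hxS).not_gt ?_⟩
    rcases hx with hx | hx
    · exact (removalTime_lt_of_mem_early hres hx.2).trans (Nat.lt_succ_self _)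
    · simp [removalTime_of_mem_half hres hx.1.2 hx.2]

theorem valueAfter_nonneg_of_savers [NeZero k] (hM : 64 * k ^ 4 ≤ M) (hMd : M ^ 2 ≤ d)
    (hs : 16 * k ^ 2 * s ≤ M) (hd : G.degree v ≤ d) (hω : BalancedAt G col d v ω)
    (hadj : ∀ x, sav x = some v → G.Adj v x)
    (hdemand : ∀ w, #{u | sav u = some w} = demand G ω (d - s) w)
    (hS : IsRemaining (removalTime col ω) S) (hv : v ∈ S) :
    0 ≤ valueAfter G (fun _ => (d - s : ℕ)) sav S v := by
  by_cases hres : ω v ∈ reserve k M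
  · refine valueAfter_nonneg_of_degree_le_add_card_fiber hadj ?_
    rw [hdemand, demand, if_pos hres]
    lia
  · refine valueAfter_nonneg_of_degree_le_add_card_inter ?_
    have hinter := card_le_card (reserve_neighbors_subset (G := G) hS hv hres)
    rcases le_or_gt (G.degree v) (d - s) with hdeg | hdeg
    · exact hdeg.trans (Nat.le_add_right _ _)
    have hreserve : s ≤ #{x ∈ G.neighborFinset v | ω x ∈ reserve k M} := by
      have := two_mul_le_of_mul_le hM hMd hs
      exact_mod_cast (le_one_fourth_mul_div hMd hs).trans (hω.le_card_reserve (by lia))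
    lia

theorem valueAfter_lt_of_mem_savers [NeZero k] (C : G.Coloring (Fin k)) (hM : 64 * k ^ 4 ≤ M)
    (hMd : M ^ 2 ≤ d) (hs : 16 * k ^ 2 * s ≤ M) (hd : ∀ v, G.degree v ≤ d)
    (hω : ∀ v, BalancedAt G C d v ω)
    (hj : (G.degree w / k : ℝ) ≤ #(colorNeighbors G C w j))
    (hdemand : ∀ w, #{u | sav u = some w} = demand G ω (d - s) w)
    (hS : IsRemaining (removalTime C ω) S) (hu : u ∈ S)
    (hmin : ∀ y ∈ S, removalTime C ω u ≤ removalTime C ω y) (hsav : sav u = some w)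
    (huw : u ∈ savers G C ω j w) :
    valueAfter G (fun _ => (d - s : ℕ)) sav S w < valueAfter G (fun _ => (d - s : ℕ)) sav S u := by
  obtain ⟨-, hcol, hhalf, hres⟩ := mem_savers.1 huw
  have htime : removalTime C ω u = 3 * j + 1 := removalTime_of_mem_half hres hcol hhalf
  have hdeg := (mem_reserve_of_sav_eq_some hdemand hsav).2
  have hsd := two_mul_le_of_mul_le hM hMd hs
  have hremoved_u := card_le_card (removed_neighbors_subset_early C hS hu hcol htime)
  have hremoved_w := card_early_add_card_half_le (G := G) (htime ▸ hmin) w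
  have hsaved_w : #(({x | sav x = some w} : Finset V) \ S) ≤ s :=
    (card_le_card sdiff_subset).trans ((hdemand w).trans_le (demand_le (hd w)))
  have hgap := (hω u).card_early_add_lt (hω w) hM hMd hs hd (by lia) (by lia) hj
  simp only [valueAfter]
  lia

end SaverAssignment

theorem weaklyDegenerate_of_balancedAt [NeZero k] (C : G.Coloring (Fin k)) (hM : 64 * k ^ 4 ≤ M)
    (hMd : M ^ 2 ≤ d) (hs : 16 * k ^ 2 * s ≤ M) (hd : ∀ v, G.degree v ≤ d)
    (hω : ∀ v, BalancedAt G C d v ω) : G.WeaklyDegenerate fun _ => d - s := by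
  classical
  choose j hj using exists_degree_div_le_card_colorNeighbors G C
  obtain ⟨sav, hsavers, hdemand⟩ := exists_saver_assignment hM hMd hs hd hω hj
  have hadj (u w : V) (h : sav u = some w) : G.Adj u w ∧ removalTime C ω u < removalTime C ω w := by
    obtain ⟨hwu, -, -, hres⟩ := mem_savers.1 (hsavers u w h)
    refine ⟨hwu.symm, ?_⟩
    rw [removalTime_of_mem_reserve (mem_reserve_of_sav_eq_some hdemand h).1]
    exact removalTime_lt_of_notMem_reserve hres
  have hremovable := removable_of_schedule (G := G) (f := fun _ => (d - s : ℕ)) hadj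
    (fun S hS v hv => valueAfter_nonneg_of_savers hM hMd hs (hd v) (hω v)
      (fun x hx => (hadj x v hx).1.symm) hdemand hS hv)
    (fun S hS u hu hmin w hsav => valueAfter_lt_of_mem_savers C hM hMd hs hd hω (hj w) hdemand hS
      hu hmin hsav (hsavers u w hsav))
    (S := univ) fun x hx => (hx (mem_univ x)).elim
  rwa [valueAfter_univ, coe_univ] at hremovable

end Removal

section ParameterChoice

open Filter in
theorem tendsto_union_bound_atTop_nhds_zero (k : ℕ) :
    Tendsto (fun M : ℕ => 4 * ((6 * k + 2) * Real.exp (-(M / 64))) * ((2 * M) ^ 2) ^ 2)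
      atTop (nhds (0 : ℝ)) := by
  have hM : Tendsto (fun M : ℕ => (M / 64 : ℝ)) atTop atTop :=
    tendsto_natCast_atTop_atTop.atTop_div_const (by norm_num)
  have h := ((Real.tendsto_pow_mul_exp_neg_atTop_nhds_zero 4).comp hM).const_mul
    (64 * 64 ^ 4 * (6 * k + 2) : ℝ)
  rw [mul_zero] at h
  refine h.congr fun M => ?_
  simp only [Function.comp_apply]
  ring

theorem sqrt_le_two_mul_nat_sqrt (d : ℕ) : √(d : ℝ) ≤ 2 * Nat.sqrt d := by
  rcases d.eq_zero_or_pos with rfl | hd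
  · simp
  · have : (1 : ℝ) ≤ Nat.sqrt d := by exact_mod_cast Nat.sqrt_pos.2 hd
    linarith [Real.real_sqrt_le_nat_sqrt_succ (a := d)]

theorem le_two_mul_mul_div {m n : ℕ} (hm : 0 < m) (h : m ≤ n) : n ≤ 2 * (m * (n / m)) := by
  have := Nat.div_add_mod n m
  have := Nat.mod_lt n hm
  have : m ≤ m * (n / m) := Nat.le_mul_of_pos_right m (Nat.div_pos h hm)
  lia

theorem exists_parameters (k : ℕ) [NeZero k] : ∃ d₀ : ℕ, ∀ d ≥ d₀, ∃ M s : ℕ,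
    64 * k ^ 4 ≤ M ∧ M ^ 2 ≤ d ∧ 16 * k ^ 2 * s ≤ M ∧
      4 * ((6 * k + 2) * Real.exp (-(M / 64))) * d ^ 2 ≤ 1 ∧
        1 / (64 * k ^ 2) * √(d : ℝ) ≤ s := by
  obtain ⟨M₀, hM₀⟩ := Filter.eventually_atTop.1
    ((tendsto_union_bound_atTop_nhds_zero k).eventually (ge_mem_nhds one_pos))
  refine ⟨(M₀ + 64 * k ^ 4) ^ 2, fun d hd => ⟨Nat.sqrt d, Nat.sqrt d / (16 * k ^ 2), ?_⟩⟩
  have hsqrt := sqrt_le_two_mul_nat_sqrt d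
  set M := Nat.sqrt d
  have hM : M₀ + 64 * k ^ 4 ≤ M := Nat.le_sqrt'.2 hd
  have hk : 0 < k := NeZero.pos k
  have hkM : 16 * k ^ 2 ≤ M := by
    have := Nat.pow_le_pow_right hk (by norm_num : 2 ≤ 4)
    lia
  have hdM : (d : ℝ) ≤ (2 * M) ^ 2 := (Real.sqrt_le_left (by positivity)).1 hsqrt
  refine ⟨by lia, Nat.sqrt_le' d, Nat.mul_div_le _ _, ?_, ?_⟩
  · exact le_trans (by gcongr) (hM₀ M (by lia))
  · have hs : (M : ℝ) ≤ 2 * (16 * k ^ 2 * (M / (16 * k ^ 2) : ℕ)) := by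
      exact_mod_cast le_two_mul_mul_div (by positivity) hkM
    rw [one_div_mul_eq_div, div_le_iff₀' (by positivity)]
    linarith

end ParameterChoice

end WeakDegeneracy

theorem theorem1p9 (k : ℕ) (hk : 1 ≤ k) :
    ∃ c : ℝ, 0 < c ∧ ∃ d₀ : ℕ,
      ∀ (V : Type*) [Fintype V] (G : SimpleGraph V) [DecidableRel G.Adj] (d : ℕ),
        G.maxDegree = d → d₀ ≤ d → G.chromaticNumber ≤ (k : ℕ∞) →
          (G.weakDegeneracy : ℝ) ≤ (d : ℝ) - c * Real.sqrt (d : ℝ) := by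
  have : NeZero k := ⟨Nat.one_le_iff_ne_zero.1 hk⟩
  obtain ⟨d₀, hd₀⟩ := WeakDegeneracy.exists_parameters k
  refine ⟨1 / (64 * k ^ 2), by positivity, d₀, fun V _ G _ d hmax hd hχ => ?_⟩
  obtain ⟨M, s, hM, hMd, hs, hexp, hsqrt⟩ := hd₀ d hd
  have : NeZero M := ⟨(hM.trans_lt' (by positivity)).ne'⟩
  have hdeg (v : V) : G.degree v ≤ d := hmax ▸ G.degree_le_maxDegree v
  obtain ⟨C⟩ := SimpleGraph.chromaticNumber_le_iff_colorable.1 hχ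
  obtain ⟨ω, hω⟩ := WeakDegeneracy.exists_forall_balancedAt C hM hMd hdeg hexp
  have hwd : G.weakDegeneracy ≤ d - s :=
    Nat.sInf_le (WeakDegeneracy.weaklyDegenerate_of_balancedAt C hM hMd hs hdeg hω)
  have hsd := WeakDegeneracy.two_mul_le_of_mul_le hM hMd hs
  have hwd' : (G.weakDegeneracy + s : ℝ) ≤ d := by exact_mod_cast (by lia)
  linarith
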